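/- Let $\mathcal X,\mathcal Y$ be finite non-empty alphabets and let $\mathcal W$ be a discrete memoryless channel from $\mathcal X$ to $\mathcal Y$, i.e. a stochastic matrix $[\mathcal W(y|x)]_{x\in\mathcal X,\,y\in\mathcal Y}$, with $n$-fold product $\mathcal W^{\times n}(y^n|x^n)=\prod_{i=1}^n\mathcal W(y_i|x_i)$. Write $\mathcal P(\mathcal X)$ for the set of probability distributions on $\mathcal X$, and for $P_X\in\mathcal P(\mathcal X)$, $Q_Y\in\mathcal P(\mathcal Y)$ put $P_{XY}(x,y)=\mathcal W(y|x)P_X(x)$ and $(P_XQ_Y)(x,y)=P_X(x)Q_Y(y)$. Logarithms are natural, $-\log 0=+\infty$, $0\cdot(\pm\infty)=0$, and all quantities below take values in $[-\infty,+\infty]$. Let $D(P\|Q)=\sum_z P(z)\log\frac{P(z)}{Q(z)}$ if $P\ll Q$ and $D(P\|Q)=+\infty$ otherwise; let $D_\alpha(P\|Q)=\frac1{\alpha-1}\log\sum_z P(z)^\alpha Q(z)^{1-\alpha}$ for $\alpha\in(0,1)$, and $D_1=D$. *Non-signalling-assisted codes.* For $M\ge1$ let $W$ be uniformly distributed on $\{1,\dots,M\}$.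 A non-signalling-assisted code with $M$ messages for $\mathcal W$ is a family of conditional probability distributions $\mathcal Z(x,\hat w|y,w)$, with $x\in\mathcal X$, $y\in\mathcal Y$, $w,\hat w\in\{1,\dots,M\}$, such that $\sum_{x}\mathcal Z(x,\hat w|y,w)$ does not depend on $w$ and $\sum_{\hat w}\mathcal Z(x,\hat w|y,w)$ does not depend on $y$. Its average error probability over $\mathcal W$ is $$\mathbb P[W\ne\hat W]=\frac1M\sum_{w}\sum_{x,y}\sum_{\hat w\neq w}\mathcal W(y|x)\,\mathcal Z(x,\hat w|y,w),$$ and $\epsilon^{\mathrm{NS}}(M,\mathcal W)$ is the minimum of this over all such codes. Define $$E^{\mathrm{NS}}(r,\mathcal W)=\liminf_{n\to\infty}-\tfrac1n\log\epsilon^{\mathrm{NS}}\big(\lceil e^{rn}\rceil,\mathcal W^{\times n}\big),\qquad E^{\mathrm{NS}}(0^+,\mathcal W)=\liminf_{r\to0^+}E^{\mathrm{NS}}(r,\mathcal W),$$ $$E^{\mathrm{NS}}_0(\mathcal W)=\liminf_{M\to\infty}\,\liminf_{n\to\infty}-\tfrac1n\log\epsilon^{\mathrm{NS}}(M,\mathcal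 W^{\times n}).$$ *Sphere-packing bound and umlaut information.* For $r>0$ define $$E_{\mathrm{sp}}(r,\mathcal W)=\sup_{\alpha\in(0,1]}\ \sup_{P_X\in\mathcal P(\mathcal X)}\ \inf_{Q_Y\in\mathcal P(\mathcal Y)}\ \frac{1-\alpha}{\alpha}\Big(D_\alpha(P_{XY}\|P_XQ_Y)-r\Big),$$ and define the channel umlaut information $$U(\mathcal W)=\sup_{P_X\in\mathcal P(\mathcal X)}\ \inf_{Q_Y\in\mathcal P(\mathcal Y)}\ D(P_XQ_Y\|P_{XY}).$$ **Theorem.** The limit $E_{\mathrm{sp}}(0^+,\mathcal W)=\lim_{r\to0^+}E_{\mathrm{sp}}(r,\mathcal W)$ exists in $[-\infty,+\infty]$, and $$E^{\mathrm{NS}}_0(\mathcal W)=E^{\mathrm{NS}}(0^+,\mathcal W)=E_{\mathrm{sp}}(0^+,\mathcal W)=U(\mathcal W).$$ -/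

import Mathlib

open Filter Topology

noncomputable section

namespace Umlaut

/-- `Prob α` is the set of probability distributions on the finite alphabet `α`. -/
abbrev Prob (α : Type*) [Fintype α] : Type _ := stdSimplex ℝ α

/-- A discrete memoryless channel from `X` to `Y`: a stochastic matrix, `W x y = W(y|x)`. -/
abbrev Channel (X Y : Type*) [Fintype Y] : Type _ := X → Prob Y

section Divergences

variable {α : Type*} [Fintype α]

theorem Prob.nonneg (P : Prob α) (x : α) : 0 ≤ P x := P.2.1 x

theorem Prob.sum_eq_one (P : Prob α) : ∑ x, P x = 1 := P.2.2

/-- The measure on the discrete space `α` with probability mass function `P`. -/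
def Prob.toMeasure (P : Prob α) : @MeasureTheory.Measure α ⊤ :=
  letI : MeasurableSpace α := ⊤
  ∑ x, ENNReal.ofReal (P x) • MeasureTheory.Measure.dirac x

/-- The relative entropy `D(P‖Q)`, with value `⊤` if `P` is not absolutely continuous with
respect to `Q`. -/
def relEntropy (P Q : Prob α) : EReal :=
  ((@InformationTheory.klDiv α ⊤ P.toMeasure Q.toMeasure : ENNReal) : EReal)

theorem Prob.toMeasure_singleton (P : Prob α) (x : α) :
    P.toMeasure {x} = ENNReal.ofReal (P x) := by
  classical
  let _ : MeasurableSpace α := ⊤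
  simp only [Prob.toMeasure, MeasureTheory.Measure.coe_finsetSum, Finset.sum_apply,
    MeasureTheory.Measure.smul_apply, smul_eq_mul]
  rw [Finset.sum_eq_single x]
  · simp
  · intro y _ hy
    simp [hy]
  · simp

theorem Prob.toMeasure_univ (P : Prob α) : P.toMeasure Set.univ = 1 := by
  let _ : MeasurableSpace α := ⊤
  simp only [Prob.toMeasure, MeasureTheory.Measure.coe_finsetSum, Finset.sum_apply,
    MeasureTheory.Measure.smul_apply, smul_eq_mul, MeasureTheory.measure_univ, mul_one]
  rw [← ENNReal.ofReal_sum_of_nonneg (fun x _ => P.nonneg x), P.sum_eq_one,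
    ENNReal.ofReal_one]

open scoped Classical in
/-- The relative entropy in terms of probability mass functions. -/
theorem relEntropy_eq (P Q : Prob α) :
    relEntropy P Q =
      if ∀ x, Q x = 0 → P x = 0 then ((∑ x, P x * Real.log (P x / Q x) : ℝ) : EReal) else ⊤ := by
  let _ : MeasurableSpace α := ⊤
  have : DiscreteMeasurableSpace α := ⟨fun _ => trivial⟩
  have hP : MeasureTheory.IsProbabilityMeasure P.toMeasure := ⟨P.toMeasure_univ⟩
  have hQ : MeasureTheory.IsProbabilityMeasure Q.toMeasure := ⟨Q.toMeasure_univ⟩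
  have h0 : ∀ (R : Prob α) (x : α), R.toMeasure {x} = 0 ↔ R x = 0 := by
    intro R x
    rw [R.toMeasure_singleton, ENNReal.ofReal_eq_zero]
    exact ⟨fun h => le_antisymm h (R.nonneg x), fun h => h.le⟩
  unfold relEntropy
  split_ifs with h
  · have hac : MeasureTheory.Measure.AbsolutelyContinuous P.toMeasure Q.toMeasure := by
      intro s hs
      have hsf : s = ⋃ x ∈ s, {x} := by simp
      rw [hsf, MeasureTheory.measure_biUnion_null_iff (Set.to_countable s)]
      intro x hx
      rw [h0]
      apply h
      rw [← h0]
      exact MeasureTheory.measure_mono_null (by simpa using hx) hs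
    have hint : MeasureTheory.Integrable (MeasureTheory.llr P.toMeasure Q.toMeasure)
        P.toMeasure := MeasureTheory.Integrable.of_finite
    have hne := InformationTheory.klDiv_ne_top hac hint
    have hr := InformationTheory.toReal_klDiv_of_measure_eq hac
      (by rw [P.toMeasure_univ, Q.toMeasure_univ])
    have hval : (InformationTheory.klDiv P.toMeasure Q.toMeasure).toReal
        = ∑ x, P x * Real.log (P x / Q x) := by
      rw [hr, MeasureTheory.integral_fintype hint]
      refine Finset.sum_congr rfl fun x _ => ?_
      rw [MeasureTheory.measureReal_def, P.toMeasure_singleton,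
        ENNReal.toReal_ofReal (P.nonneg x), smul_eq_mul]
      by_cases hx : Q x = 0
      · simp [h x hx]
      · congr 1
        have hd : (P.toMeasure.rnDeriv Q.toMeasure x) * ENNReal.ofReal (Q x)
            = ENNReal.ofReal (P x) := by
          rw [← P.toMeasure_singleton, ← Q.toMeasure_singleton]
          conv_rhs => rw [← MeasureTheory.Measure.withDensity_rnDeriv_eq _ _ hac]
          rw [MeasureTheory.withDensity_apply _ (MeasurableSet.singleton x),
            MeasureTheory.lintegral_singleton]
        have hd' := congrArg ENNReal.toReal hd
        rw [ENNReal.toReal_mul, ENNReal.toReal_ofReal (P.nonneg x),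
          ENNReal.toReal_ofReal (Q.nonneg x)] at hd'
        rw [MeasureTheory.llr, ← hd']
        congr 1
        field_simp
    rw [← hval]
    exact (EReal.coe_ennreal_toReal hne).symm
  · push Not at h
    obtain ⟨x, hx, hx'⟩ := h
    rw [InformationTheory.klDiv_of_not_ac]
    · simp
    · intro hac
      exact hx' ((h0 P x).1 (hac ((h0 Q x).2 hx)))

/-- The Rényi relative entropy of order `a > 0`: for `a ≠ 1` it is
`(a - 1)⁻¹ log ∑ x, P(x) ^ a Q(x) ^ (1 - a)`, and for `a = 1` it is the relative entropy.
The sum is taken in `[0, ∞]`, where `0 * ∞ = 0`, `log 0 = -∞` and `log ∞ = ∞`. -/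
def renyiDiv (a : ℝ) (P Q : Prob α) : EReal :=
  if a = 1 then relEntropy P Q
  else (((a - 1)⁻¹ : ℝ) : EReal) *
    ENNReal.log (∑ x, ENNReal.ofReal (P x) ^ a * ENNReal.ofReal (Q x) ^ (1 - a))

end Divergences

section Channels

variable {X Y : Type*} [Fintype X] [Fintype Y]

/-- The product distribution `P_X Q_Y`. -/
def prodDist (P : Prob X) (Q : Prob Y) : Prob (X × Y) :=
  ⟨fun z => P z.1 * Q z.2, fun z => mul_nonneg (P.nonneg z.1) (Q.nonneg z.2), by
    have hP : ∑ x, P x = 1 := P.sum_eq_one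
    have hQ : ∑ y, Q y = 1 := Q.sum_eq_one
    simp [Fintype.sum_prod_type, ← Finset.mul_sum, hP, hQ]⟩

/-- The joint distribution `P_XY(x, y) = W(y|x) P_X(x)` of the input and the output. -/
def jointDist (P : Prob X) (W : Channel X Y) : Prob (X × Y) :=
  ⟨fun z => W z.1 z.2 * P z.1, fun z => mul_nonneg ((W z.1).nonneg z.2) (P.nonneg z.1), by
    have hP : ∑ x, P x = 1 := P.sum_eq_one
    have hW : ∀ x, ∑ y, W x y = 1 := fun x => (W x).sum_eq_one
    simp [Fintype.sum_prod_type, ← Finset.sum_mul, hP, hW]⟩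

/-- The channel umlaut information `U(W) = sup_{P_X} inf_{Q_Y} D(P_X Q_Y ‖ P_XY)`. -/
def channelUmlaut (W : Channel X Y) : EReal :=
  ⨆ P : Prob X, ⨅ Q : Prob Y, relEntropy (prodDist P Q) (jointDist P W)

/-- The sphere-packing bound at rate `r`,
`sup_{a ∈ (0,1]} sup_{P_X} inf_{Q_Y} ((1 - a) / a) (D_a(P_XY ‖ P_X Q_Y) - r)`. -/
def spherePacking (r : ℝ) (W : Channel X Y) : EReal :=
  ⨆ a : Set.Ioc (0 : ℝ) 1, ⨆ P : Prob X, ⨅ Q : Prob Y,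
    (((1 - (a : ℝ)) / (a : ℝ) : ℝ) : EReal) *
      (renyiDiv (a : ℝ) (jointDist P W) (prodDist P Q) - (r : EReal))

/-- The `n`-fold product channel, `W^n(y^n|x^n) = ∏ i, W(y_i|x_i)`. -/
def Channel.pow (W : Channel X Y) (n : ℕ) : Channel (Fin n → X) (Fin n → Y) := fun x =>
  ⟨fun y => ∏ i, W (x i) (y i), fun y => Finset.prod_nonneg fun i _ => (W (x i)).nonneg (y i), by
    classical
    have hW : ∀ i, ∑ y, W (x i) y = 1 := fun i => (W (x i)).sum_eq_one
    have h := Finset.prod_univ_sum (fun _ : Fin n => (Finset.univ : Finset Y))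
      (fun i y => W (x i) y)
    simp only [hW, Finset.prod_const_one, Fintype.piFinset_univ] at h
    exact h.symm⟩

/-- A code with `M` messages for channels from `X` to `Y`: conditional distributions
`Z y w (x, v) = Z(x, v | y, w)` of the channel input `x` and the estimate `v` of the message, given
the channel output `y` and the message `w`. -/
abbrev Code (X Y : Type*) [Fintype X] (M : ℕ) : Type _ := Y → Fin M → Prob (X × Fin M)

/-- A code is non-signalling if, given the message and the channel output, the law of the estimate
does not depend on the message and the law of the channel input does not depend on the
output. -/
def Code.IsNonSignalling {X Y : Type*} [Fintype X] {M : ℕ} (Z : Code X Y M) : Prop :=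
  (∀ (y : Y) (w w' : Fin M) (v : Fin M), ∑ x, Z y w (x, v) = ∑ x, Z y w' (x, v)) ∧
  (∀ (y y' : Y) (w : Fin M) (x : X), ∑ v, Z y w (x, v) = ∑ v, Z y' w (x, v))

/-- The average probability that the estimate differs from the message, when the message is
uniformly distributed, the channel is `W` and the code is `Z`. -/
def Code.errorProb {M : ℕ} (Z : Code X Y M) (W : Channel X Y) : ℝ :=
  ∑ w : Fin M, ∑ x : X, ∑ y : Y, ∑ v : Fin M,
    if v ≠ w then (1 / (M : ℝ)) * (W x y * Z y w (x, v)) else 0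

/-- The minimum average error probability of non-signalling-assisted codes with `M` messages. -/
def nsError (M : ℕ) (W : Channel X Y) : ℝ :=
  ⨅ Z : {Z : Code X Y M // Z.IsNonSignalling}, Z.1.errorProb W

/-- `-(1/n) log ε(M, W^n)`, where `-log 0 = ∞`. -/
def nsErrorRate (M n : ℕ) (W : Channel X Y) : EReal :=
  ((1 / (n : ℝ) : ℝ) : EReal) * -ENNReal.log (ENNReal.ofReal (nsError M (W.pow n)))

/-- The non-signalling-assisted error exponent at communication rate `r`. -/
def nsExponent (r : ℝ) (W : Channel X Y) : EReal :=
  liminf (fun n : ℕ => nsErrorRate ⌈Real.exp (r * n)⌉₊ n W) atTop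

/-- The non-signalling-assisted zero-rate error exponent `E(0⁺, W)`. -/
def nsZeroRateExponent (W : Channel X Y) : EReal :=
  liminf (fun r : ℝ => nsExponent r W) (𝓝[>] 0)

/-- The non-signalling-assisted error exponent at constant, arbitrarily large message size. -/
def nsFixedSizeExponent (W : Channel X Y) : EReal :=
  liminf (fun M : ℕ => liminf (fun n : ℕ => nsErrorRate M n W) atTop) atTop

end Channels

end Umlaut

end

/-!
The error of non-signalling codes, the sphere-packing bound and the umlaut information are compared
through the sums `g_s(P) = ∑ y, (∑ x, P(x) W(y|x) ^ s) ^ (1 / s)` (`gallagerSum`). As `s → 0⁺` the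
power means become geometric means, so `g_s(P)` tends to `∑ y, ∏ x, W(y|x) ^ P(x)`
(`tendsto_gallagerSum`), and minus the logarithm of this limit is at least `inf_Q D(PQ‖P_XY)`, by
taking for `Q` the normalised geometric mean (`iInf_relEntropy_le_neg_log`). Hence whatever is at
least `-log g_s(P) - c_s r` at every rate `r > 0`, for all `s` and `P`, is at least the umlaut
information in the limit `r → 0⁺` (`channelUmlaut_le_liminf`).

A non-signalling code amounts to an input distribution `P` together with sub-distributions
`R(·, y) ≤ P` of mass `1 / M`, on which the message is decoded correctly
(`nsError_le_of_sum_le`, `Code.IsNonSignalling.exists_errorProb_eq`).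

* Achievability: letting `R` be `P` restricted to `W(y|x) ^ s > M ∑ x', P(x') W(y|x') ^ s` gives
  an error of at most `M ^ (1 / s) g_s(P)`, and `g_s` is multiplicative. So the exponent at rate `r`
  is at least `-log g_s(P) - r / s`, and the zero-rate exponent is at least the umlaut information.
* The zero-rate exponent is at most the exponent at fixed size, as the error is monotone in `M`.
* Converse: the test `P - R` has probability `1 - 1 / M` under `P Q`, for every `Q`, and its
  probability under `P W` is the error. Data processing bounds the error from below by
  `exp (-(D(PQ‖PW) + 1) / (1 - 1 / M))` (`exp_le_error_of_test`). On the product channel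
  a product distribution `Q` makes `D(PQ‖PW^n)` a sum over the marginals of `P`
  (`exists_output_pow`), so the fixed-size exponent is at most the umlaut information.

The sphere-packing bound at rate `r` is at most the umlaut information, by Jensen's inequality, and
at least `-log g_a(P) - r (1 - a) / a`, by Hölder's inequality; so it has the same limit.
-/

namespace Umlaut

theorem Prob.le_one {α : Type*} [Fintype α] (P : Prob α) (x : α) : P x ≤ 1 := by
  have h : P x ≤ ∑ x, P x :=
    Finset.single_le_sum (f := fun x => P x) (fun v _ => P.nonneg v) (Finset.mem_univ x)
  rwa [P.sum_eq_one] at h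

theorem nonempty_output {X Y : Type*} [Nonempty X] [Fintype Y] (W : Channel X Y) : Nonempty Y := by
  by_contra h
  rw [not_nonempty_iff] at h
  have := (W (Classical.arbitrary X)).sum_eq_one
  simp at this

/-- The set of codes is nonempty, so that `nsError` is a genuine infimum and not the default value
`0` of an empty one. -/
theorem exists_isNonSignalling {X Y : Type*} [Fintype X] [Nonempty X] {M : ℕ} (hM : 0 < M) :
    ∃ Z : Code X Y M, Z.IsNonSignalling := by
  classical
  let z : X × Fin M := (Classical.arbitrary X, ⟨0, hM⟩)
  exact ⟨fun _ _ => ⟨Pi.single z 1, single_mem_stdSimplex ℝ z⟩,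
    fun _ _ _ _ => rfl, fun _ _ _ _ => rfl⟩

/-! ### One-shot bounds on the error of non-signalling codes -/

section OneShot

variable {X Y : Type*} [Fintype X] [Fintype Y] {M : ℕ}

theorem Code.errorProb_nonneg (Z : Code X Y M) (W : Channel X Y) : 0 ≤ Z.errorProb W := by
  refine Finset.sum_nonneg fun w _ => Finset.sum_nonneg fun x _ => Finset.sum_nonneg fun y _ =>
    Finset.sum_nonneg fun v _ => ?_
  split_ifs
  · exact mul_nonneg (by positivity) (mul_nonneg ((W x).nonneg y) ((Z y w).nonneg _))
  · exact le_rfl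

theorem nsError_le_errorProb {Z : Code X Y M} (hZ : Z.IsNonSignalling) (W : Channel X Y) :
    nsError M W ≤ Z.errorProb W :=
  ciInf_le ⟨0, by rintro _ ⟨Z, rfl⟩; exact Z.1.errorProb_nonneg W⟩
    (⟨Z, hZ⟩ : {Z : Code X Y M // Z.IsNonSignalling})

theorem sum_ite_eq_add_mul (w : Fin M) (a b : ℝ) :
    ∑ v, (if v = w then a else b) = a + (M - 1) * b := by
  have h : ∀ v, (if v = w then a else b) = b + if v = w then a - b else 0 := by
    intro v; split_ifs <;> ring
  simp only [h, Finset.sum_add_distrib]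
  simp
  ring

/-- The code decodes correctly with sub-law `R · y` and spreads the remaining mass `P - R · y`
evenly over the wrong messages. As `R · y` has mass exactly `1 / M`, the estimate is uniform
whatever the message, so the code is non-signalling. -/
theorem nsError_le_of_sum_eq (W : Channel X Y) (P : Prob X) (R : X → Y → ℝ) (hM : 2 ≤ M)
    (h0 : ∀ x y, 0 ≤ R x y) (h1 : ∀ x y, R x y ≤ P x) (h2 : ∀ y, ∑ x, R x y = 1 / M) :
    nsError M W ≤ ∑ x, ∑ y, W x y * (P x - R x y) := by
  have hM' : (0 : ℝ) < M - 1 := by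
    have : (2 : ℝ) ≤ M := by exact_mod_cast hM
    linarith
  have hM0 : (M : ℝ) ≠ 0 := by linarith
  have hP : ∑ x, P x = 1 := P.sum_eq_one
  have hsum : ∀ (w : Fin M) x y,
      ∑ v, (if v = w then R x y else (P x - R x y) / (M - 1)) = P x := by
    intro w x y
    rw [sum_ite_eq_add_mul]
    field_simp
    ring
  let Z : Code X Y M := fun y w =>
    ⟨fun z => if z.2 = w then R z.1 y else (P z.1 - R z.1 y) / (M - 1), by
      intro z
      dsimp only
      split_ifs
      · exact h0 _ _
      · exact div_nonneg (sub_nonneg.2 (h1 _ _)) hM'.le, by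
      rw [Fintype.sum_prod_type]
      simp only [hsum, hP]⟩
  have hZ : ∀ y w x v, Z y w (x, v) = if v = w then R x y else (P x - R x y) / (M - 1) :=
    fun _ _ _ _ => rfl
  have hNS : Z.IsNonSignalling := by
    constructor
    · have h : ∀ y (w v : Fin M), ∑ x, Z y w (x, v) = 1 / M := by
        intro y w v
        simp only [hZ]
        split_ifs
        · exact h2 y
        · rw [← Finset.sum_div, Finset.sum_sub_distrib, h2, hP]
          field_simp
      intro y w w' v
      rw [h, h]
    · intro y y' w x
      simp only [hZ, hsum]
  refine (nsError_le_errorProb hNS W).trans_eq ?_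
  have key : ∀ (w : Fin M) x y, (∑ v, if v ≠ w then (1 / (M : ℝ)) * (W x y * Z y w (x, v)) else 0)
      = 1 / M * (W x y * (P x - R x y)) := by
    intro w x y
    have h : ∀ v, (if v ≠ w then (1 / (M : ℝ)) * (W x y * Z y w (x, v)) else 0)
        = if v = w then 0 else (1 / (M : ℝ)) * (W x y * ((P x - R x y) / (M - 1))) := by
      intro v
      rw [hZ]
      by_cases hv : v = w <;> simp [hv]
    simp only [h]
    rw [sum_ite_eq_add_mul]
    field_simp
    ring
  simp only [Code.errorProb, key, ← Finset.mul_sum]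
  simp only [Finset.sum_const, Finset.card_univ, Fintype.card_fin, nsmul_eq_mul]
  field_simp

/-- A non-signalling code only matters through an input distribution `P` and the sub-distributions
`R · y ≤ P` on which the message is decoded correctly; these may be any with total mass at most
`1 / M`. If the mass falls short of `1 / M`, moving `R · y` towards `P` makes up for it and only
lowers the error. -/
theorem nsError_le_of_sum_le [Nonempty X] (W : Channel X Y) (P : Prob X) (R : X → Y → ℝ)
    (hM : 0 < M) (h0 : ∀ x y, 0 ≤ R x y) (h1 : ∀ x y, R x y ≤ P x)
    (h2 : ∀ y, ∑ x, R x y ≤ 1 / M) :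
    nsError M W ≤ ∑ x, ∑ y, W x y * (P x - R x y) := by
  have hP : ∑ x, P x = 1 := P.sum_eq_one
  -- With a single message there is no wrong estimate to spread mass over, but also no error.
  rcases Nat.lt_or_ge M 2 with hM2 | hM2
  · obtain rfl : M = 1 := by omega
    obtain ⟨Z, hZ⟩ := exists_isNonSignalling (X := X) (Y := Y) (M := 1) one_pos
    refine (nsError_le_errorProb hZ W).trans ?_
    have : Z.errorProb W = 0 := by
      simp [Code.errorProb, Subsingleton.elim _ (0 : Fin 1)]
    rw [this]
    exact Finset.sum_nonneg fun x _ => Finset.sum_nonneg fun y _ =>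
      mul_nonneg ((W x).nonneg y) (sub_nonneg.2 (h1 x y))
  · have hMr : (1 : ℝ) / M ≤ 1 / 2 := by
      gcongr
      exact_mod_cast hM2
    set ρ : Y → ℝ := fun y => ∑ x, R x y with hρ
    set c : Y → ℝ := fun y => (1 / M - ρ y) / (1 - ρ y) with hc
    have hρ1 : ∀ y, 0 < 1 - ρ y := fun y => by have := h2 y; simp only [hρ]; linarith
    have hc0 : ∀ y, 0 ≤ c y := fun y => div_nonneg (sub_nonneg.2 (h2 y)) (hρ1 y).le
    have hc1 : ∀ y, c y ≤ 1 := fun y => (div_le_one (hρ1 y)).2 (by linarith)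
    refine (nsError_le_of_sum_eq W P (fun x y => R x y + c y * (P x - R x y)) hM2 ?_ ?_ ?_).trans ?_
    · intro x y
      exact add_nonneg (h0 x y) (mul_nonneg (hc0 y) (sub_nonneg.2 (h1 x y)))
    · intro x y
      nlinarith [h1 x y, hc1 y]
    · intro y
      rw [Finset.sum_add_distrib, ← Finset.mul_sum, Finset.sum_sub_distrib, hP]
      change ρ y + c y * (1 - ρ y) = _
      rw [hc]
      have := (hρ1 y).ne'
      field_simp
      ring
    · gcongr with x _ y _
      · exact (W x).nonneg y
      · exact le_add_of_nonneg_right (mul_nonneg (hc0 y) (sub_nonneg.2 (h1 x y)))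

/-- Every non-signalling code reduces to the data of `nsError_le_of_sum_le`: average over the
messages the law of the input and the sub-law of the input on correct decoding. -/
theorem Code.IsNonSignalling.exists_errorProb_eq {Z : Code X Y M} (hZ : Z.IsNonSignalling)
    [Nonempty Y] (hM : 0 < M) (W : Channel X Y) :
    ∃ (P : Prob X) (R : X → Y → ℝ), (∀ x y, 0 ≤ R x y) ∧ (∀ x y, R x y ≤ P x) ∧
      (∀ y, ∑ x, R x y = 1 / M) ∧ Z.errorProb W = ∑ x, ∑ y, W x y * (P x - R x y) := by
  have hM0 : (M : ℝ) ≠ 0 := by positivity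
  let y₀ : Y := Classical.arbitrary Y
  have hZ1 : ∀ y w, ∑ x, ∑ v, Z y w (x, v) = 1 := fun y w => by
    rw [← Fintype.sum_prod_type]; exact (Z y w).sum_eq_one
  let P : Prob X := ⟨fun x => ∑ w, 1 / (M : ℝ) * ∑ v, Z y₀ w (x, v), by
    intro x
    exact Finset.sum_nonneg fun w _ => mul_nonneg (by positivity)
      (Finset.sum_nonneg fun v _ => (Z y₀ w).nonneg _), by
    rw [Finset.sum_comm]
    simp only [← Finset.mul_sum, hZ1]
    simp [hM0]⟩
  have hP : ∀ x y, P x = ∑ w, 1 / (M : ℝ) * ∑ v, Z y w (x, v) := by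
    intro x y
    change ∑ w, 1 / (M : ℝ) * ∑ v, Z y₀ w (x, v) = _
    exact Finset.sum_congr rfl fun w _ => by rw [hZ.2 y₀ y w x]
  refine ⟨P, fun x y => ∑ w, 1 / (M : ℝ) * Z y w (x, w), ?_, ?_, ?_, ?_⟩
  · intro x y
    exact Finset.sum_nonneg fun w _ => mul_nonneg (by positivity) ((Z y w).nonneg _)
  · intro x y
    rw [hP x y]
    refine Finset.sum_le_sum fun w _ => mul_le_mul_of_nonneg_left ?_ (by positivity)
    exact Finset.single_le_sum (f := fun v => Z y w (x, v)) (fun v _ => (Z y w).nonneg _)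
      (Finset.mem_univ w)
  · intro y
    rw [Finset.sum_comm]
    simp only [← Finset.mul_sum]
    let w₀ : Fin M := ⟨0, hM⟩
    have h : ∀ w, ∑ x, Z y w (x, w) = ∑ x, Z y w₀ (x, w) := fun w => hZ.1 y w w₀ w
    simp only [h]
    rw [Finset.sum_comm, hZ1, mul_one]
  · rw [Code.errorProb, Finset.sum_comm]
    refine Finset.sum_congr rfl fun x _ => ?_
    rw [Finset.sum_comm]
    refine Finset.sum_congr rfl fun y _ => ?_
    rw [hP x y, ← Finset.sum_sub_distrib, Finset.mul_sum]
    refine Finset.sum_congr rfl fun w _ => ?_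
    have h : ∀ v, (if v ≠ w then (1 / (M : ℝ)) * (W x y * Z y w (x, v)) else 0)
        = 1 / (M : ℝ) * (W x y * Z y w (x, v))
          - if v = w then 1 / (M : ℝ) * (W x y * Z y w (x, w)) else 0 := by
      intro v
      by_cases hv : v = w <;> simp [hv]
    simp only [h, Finset.sum_sub_distrib, ← Finset.mul_sum]
    simp
    ring

theorem nsError_mono [Nonempty X] (W : Channel X Y) {M M' : ℕ} (hM : 0 < M) (h : M ≤ M') :
    nsError M W ≤ nsError M' W := by
  have hM' : 0 < M' := hM.trans_le h
  have := nonempty_output W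
  obtain ⟨Z₀, hZ₀⟩ := exists_isNonSignalling (X := X) (Y := Y) hM'
  have : Nonempty {Z : Code X Y M' // Z.IsNonSignalling} := ⟨⟨Z₀, hZ₀⟩⟩
  refine le_ciInf fun Z => ?_
  obtain ⟨P, R, h0, h1, h2, he⟩ := Z.2.exists_errorProb_eq hM' W
  rw [he]
  refine nsError_le_of_sum_le W P R hM h0 h1 fun y => ?_
  rw [h2]
  gcongr

theorem sum_mul_joint (P : Prob X) (W : Channel X Y) : ∑ x, ∑ y, W x y * P x = 1 := by
  have := (jointDist P W).sum_eq_one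
  rwa [Fintype.sum_prod_type] at this

/-- The sum `∑ y, (∑ x, P(x) W(y|x) ^ s) ^ (1 / s)`, whose negative logarithm is Gallager's function
`E₀(1 / s - 1, P)`. -/
noncomputable def gallagerSum (s : ℝ) (P : Prob X) (W : Channel X Y) : ℝ :=
  ∑ y, (∑ x, P x * W x y ^ s) ^ (1 / s)

theorem sum_mul_rpow_nonneg (s : ℝ) (P : Prob X) (W : Channel X Y) (y : Y) :
    0 ≤ ∑ x, P x * W x y ^ s :=
  Finset.sum_nonneg fun x _ => mul_nonneg (P.nonneg x) (Real.rpow_nonneg ((W x).nonneg y) s)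

theorem gallagerSum_nonneg (s : ℝ) (P : Prob X) (W : Channel X Y) : 0 ≤ gallagerSum s P W :=
  Finset.sum_nonneg fun y _ => Real.rpow_nonneg (sum_mul_rpow_nonneg s P W y) _

/-- Achievability: decode correctly where `W(y|x) ^ s` exceeds `M` times its `P`-average. By
Markov's inequality this has `P`-probability at most `1 / M`, and elsewhere `W(y|x)` is small. -/
theorem nsError_le_gallagerSum [Nonempty X] (W : Channel X Y) (P : Prob X) (hM : 0 < M)
    {s : ℝ} (hs : 0 < s) : nsError M W ≤ (M : ℝ) ^ (1 / s) * gallagerSum s P W := by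
  classical
  have hM0 : (0 : ℝ) < M := by exact_mod_cast hM
  have hP : ∑ x, P x = 1 := P.sum_eq_one
  set c : Y → ℝ := fun y => ∑ x, P x * W x y ^ s with hc
  have hc0 : ∀ y, 0 ≤ c y := sum_mul_rpow_nonneg s P W
  refine (nsError_le_of_sum_le W P (fun x y => if M * c y < W x y ^ s then P x else 0) hM
    ?_ ?_ ?_).trans ?_
  · intro x y
    split_ifs
    exacts [P.nonneg x, le_rfl]
  · intro x y
    split_ifs
    exacts [le_rfl, P.nonneg x]
  · intro y
    -- Where `c y = 0`, the strict inequality holds only for inputs of probability zero.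
    rcases (hc0 y).eq_or_lt with h | h
    · rw [Finset.sum_eq_zero]
      · positivity
      · intro x _
        have hx := (Finset.sum_eq_zero_iff_of_nonneg (fun x _ => mul_nonneg (P.nonneg x)
          (Real.rpow_nonneg ((W x).nonneg y) s))).1 h.symm x (Finset.mem_univ x)
        split_ifs with hlt
        · rw [← h, mul_zero] at hlt
          exact (mul_eq_zero.1 hx).resolve_right hlt.ne'
        · rfl
    · have : (∑ x, if M * c y < W x y ^ s then P x else 0) * (M * c y) ≤ c y := by
        rw [Finset.sum_mul]
        refine Finset.sum_le_sum fun x _ => ?_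
        split_ifs with hlt
        · exact mul_le_mul_of_nonneg_left hlt.le (P.nonneg x)
        · rw [zero_mul]
          exact mul_nonneg (P.nonneg x) (Real.rpow_nonneg ((W x).nonneg y) s)
      rw [le_div_iff₀ hM0]
      refine le_of_mul_le_mul_right ?_ h
      linarith
  · have key : ∀ x y, W x y * (P x - if M * c y < W x y ^ s then P x else 0)
        ≤ P x * ((M : ℝ) ^ (1 / s) * c y ^ (1 / s)) := by
      intro x y
      rw [← Real.mul_rpow hM0.le (hc0 y)]
      split_ifs with hlt
      · rw [sub_self, mul_zero]
        exact mul_nonneg (P.nonneg x) (Real.rpow_nonneg (mul_nonneg hM0.le (hc0 y)) _)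
      · rw [sub_zero, mul_comm]
        refine mul_le_mul_of_nonneg_left ?_ (P.nonneg x)
        calc W x y = (W x y ^ s) ^ (1 / s) := by
              rw [← Real.rpow_mul ((W x).nonneg y), mul_one_div_cancel hs.ne', Real.rpow_one]
          _ ≤ _ := Real.rpow_le_rpow (Real.rpow_nonneg ((W x).nonneg y) s) (not_lt.1 hlt)
              (by positivity)
    calc _ ≤ ∑ x, ∑ y, P x * ((M : ℝ) ^ (1 / s) * c y ^ (1 / s)) :=
          Finset.sum_le_sum fun x _ => Finset.sum_le_sum fun y _ => key x y
      _ = _ := by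
          simp only [← Finset.mul_sum]
          rw [← Finset.sum_mul, hP, one_mul, gallagerSum]

/-- The convex function `q ↦ q log (q / w)` lies above its tangent line at `q = exp l * w`. -/
theorem mul_log_div_ge {q w : ℝ} (hq : 0 ≤ q) (hw : 0 < w) (l : ℝ) :
    q * (1 + l) - Real.exp l * w ≤ q * Real.log (q / w) := by
  rcases hq.eq_or_lt with rfl | hq
  · simp; positivity
  · have h := Real.log_le_sub_one_of_pos (x := Real.exp l * w / q) (by positivity)
    rw [Real.log_div (by positivity) hq.ne', Real.log_mul (by positivity) hw.ne',
      Real.log_exp] at h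
    rw [Real.log_div hq.ne' hw.ne']
    have h2 := mul_le_mul_of_nonneg_left h hq.le
    have h3 : q * (Real.exp l * w / q - 1) = Real.exp l * w - q := by field_simp
    rw [h3] at h2
    nlinarith

/-- The converse for a single test: if `R` accepts with probability `δ` under `P Q`, then `D(PQ‖PW)`
bounds the error `∑ W (P - R)` from below. This is the data processing inequality with the tangent
line of `t log t` in place of the exact binary divergence. -/
theorem exp_le_error_of_test (W : Channel X Y) (P : Prob X) (Q : Prob Y) (R : X → Y → ℝ)
    {δ D : ℝ} (hδ : δ < 1) (h0 : ∀ x y, 0 ≤ R x y) (h1 : ∀ x y, R x y ≤ P x)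
    (h2 : ∀ y, ∑ x, R x y = δ) (hac : ∀ x y, W x y = 0 → P x * Q y = 0)
    (hD : ∑ x, ∑ y, P x * Q y * Real.log (Q y / W x y) ≤ D) :
    Real.exp (-((D + 1) / (1 - δ))) ≤ ∑ x, ∑ y, W x y * (P x - R x y) := by
  -- `l` is the slope parameter for which the tangent bound becomes `1 ≤ exp l * error`.
  set l := (D + 1) / (1 - δ) with hl
  have hlD : l * (1 - δ) = D + 1 := div_mul_cancel₀ _ (by linarith)
  set e := ∑ x, ∑ y, W x y * (P x - R x y) with he
  have hP : ∑ x, P x = 1 := P.sum_eq_one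
  have hQ : ∑ y, Q y = 1 := Q.sum_eq_one
  have hRQ : ∑ x, ∑ y, R x y * Q y = δ := by
    rw [Finset.sum_comm]
    simp only [← Finset.sum_mul, h2]
    rw [← Finset.mul_sum, hQ, mul_one]
  have hRW : ∑ x, ∑ y, W x y * R x y = 1 - e := by
    rw [he, ← sum_mul_joint P W]
    simp only [← Finset.sum_sub_distrib]
    exact Finset.sum_congr rfl fun x _ => Finset.sum_congr rfl fun y _ => by ring
  have key : ∀ x y, (P x * Q y - R x y * Q y) * (1 + l) - Real.exp l * (W x y * (P x - R x y))
      + (R x y * Q y - W x y * R x y) ≤ P x * Q y * Real.log (Q y / W x y) := by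
    intro x y
    rcases ((W x).nonneg y).eq_or_lt with hw | hw
    · rw [← hw, hac x y hw.symm]
      rcases mul_eq_zero.1 (hac x y hw.symm) with h | h
      · have : R x y = 0 := le_antisymm (h ▸ h1 x y) (h0 x y)
        simp [this, h]
      · simp [h]
    · have ha := mul_le_mul_of_nonneg_left (mul_log_div_ge (Q.nonneg y) hw l)
        (sub_nonneg.2 (h1 x y))
      have hb := mul_le_mul_of_nonneg_left (mul_log_div_ge (Q.nonneg y) hw 0) (h0 x y)
      rw [Real.exp_zero] at hb
      nlinarith
  have hsum := (Finset.sum_le_sum fun x (_ : x ∈ Finset.univ) =>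
    Finset.sum_le_sum fun y (_ : y ∈ Finset.univ) => key x y).trans hD
  simp only [Finset.sum_add_distrib, Finset.sum_sub_distrib, ← Finset.sum_mul, ← Finset.mul_sum]
    at hsum
  rw [hP, hQ, hRQ, hRW, ← he] at hsum
  have he0 : 0 ≤ e := Finset.sum_nonneg fun x _ => Finset.sum_nonneg fun y _ =>
    mul_nonneg ((W x).nonneg y) (sub_nonneg.2 (h1 x y))
  have h3 : 1 ≤ Real.exp l * e := by nlinarith
  rw [Real.exp_neg, inv_le_iff_one_le_mul₀ (Real.exp_pos l), mul_comm]
  linarith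

end OneShot

/-! ### The umlaut information and its approximation by Gallager sums -/

section SingleLetter

variable {X Y : Type*} [Fintype X] [Fintype Y]

theorem relEntropy_prodDist_jointDist (P : Prob X) (Q : Prob Y) (W : Channel X Y)
    (h : ∀ x y, W x y = 0 → P x * Q y = 0) :
    relEntropy (prodDist P Q) (jointDist P W)
      = ((∑ x, ∑ y, P x * Q y * Real.log (Q y / W x y) : ℝ) : EReal) := by
  classical
  rw [relEntropy_eq, if_pos]
  · congr 1
    rw [Fintype.sum_prod_type]
    refine Finset.sum_congr rfl fun x _ => Finset.sum_congr rfl fun y _ => ?_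
    change P x * Q y * Real.log (P x * Q y / (W x y * P x)) = _
    by_cases hx : P x = 0
    · simp [hx]
    · rw [mul_comm (W x y), mul_div_mul_left _ _ hx]
  · rintro ⟨x, y⟩ hz
    change W x y * P x = 0 at hz
    change P x * Q y = 0
    rcases mul_eq_zero.1 hz with hz | hz
    · exact h x y hz
    · rw [hz, zero_mul]

theorem mul_eq_zero_of_relEntropy_ne_top {P : Prob X} {Q : Prob Y} {W : Channel X Y}
    (h : relEntropy (prodDist P Q) (jointDist P W) ≠ ⊤) (x : X) (y : Y) (hW : W x y = 0) :
    P x * Q y = 0 := by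
  classical
  rw [relEntropy_eq] at h
  split_ifs at h with hac
  · exact hac (x, y) (by change W x y * P x = 0; rw [hW, zero_mul])
  · exact absurd rfl h

theorem relEntropy_nonneg {α : Type*} [Fintype α] (P Q : Prob α) : 0 ≤ relEntropy P Q :=
  EReal.coe_ennreal_nonneg _

/-- As the order tends to `0`, the power means of `a` tend to its geometric mean. -/
theorem tendsto_powerMean (P : Prob X) {a : X → ℝ} (h0 : ∀ x, 0 ≤ a x) (h1 : ∀ x, a x ≤ 1) :
    Tendsto (fun s : ℝ => (∑ x, P x * a x ^ s) ^ (1 / s)) (𝓝[>] 0) (𝓝 (∏ x, a x ^ P x)) := by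
  have hP : ∑ x, P x = 1 := P.sum_eq_one
  -- If `a` vanishes on the support of `P`, the sum stays below `1 - P x₀ < 1` while the outer
  -- exponent tends to infinity; otherwise the limit is `exp` of a derivative at `s = 0`.
  by_cases hz : ∃ x, a x = 0 ∧ P x ≠ 0
  · obtain ⟨x₀, hx₀, hp⟩ := hz
    have hp0 : 0 < P x₀ := lt_of_le_of_ne (P.nonneg x₀) (Ne.symm hp)
    rw [Finset.prod_eq_zero (Finset.mem_univ x₀) (by rw [hx₀, Real.zero_rpow hp])]
    have hinv : Tendsto (fun s : ℝ => 1 / s) (𝓝[>] 0) atTop := by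
      simpa using tendsto_inv_nhdsGT_zero (𝕜 := ℝ)
    have hlim := (tendsto_rpow_atTop_of_base_lt_one (1 - P x₀)
      (by linarith [P.le_one x₀]) (by linarith)).comp hinv
    refine tendsto_of_tendsto_of_tendsto_of_le_of_le' tendsto_const_nhds hlim ?_ ?_
    · filter_upwards with s
      exact Real.rpow_nonneg (Finset.sum_nonneg fun x _ => mul_nonneg (P.nonneg x)
        (Real.rpow_nonneg (h0 x) s)) _
    · filter_upwards [self_mem_nhdsWithin] with s hs
      have hs : 0 < s := hs
      refine Real.rpow_le_rpow (Finset.sum_nonneg fun x _ => mul_nonneg (P.nonneg x)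
        (Real.rpow_nonneg (h0 x) s)) ?_ (by positivity)
      have h := Finset.single_le_sum (f := fun x => P x * (1 - a x ^ s))
        (fun x _ => mul_nonneg (P.nonneg x)
          (sub_nonneg.2 (Real.rpow_le_one (h0 x) (h1 x) hs.le))) (Finset.mem_univ x₀)
      simp only [hx₀, Real.zero_rpow hs.ne', mul_sub, mul_one, sub_zero,
        Finset.sum_sub_distrib, hP] at h
      linarith
  · push Not at hz
    set f : ℝ → ℝ := fun s => ∑ x, P x * a x ^ s with hf
    have hf0 : f 0 = 1 := by simp [hf, hP]
    have hd : HasDerivAt f (∑ x, P x * Real.log (a x)) 0 := by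
      refine HasDerivAt.fun_sum fun x _ => ?_
      rcases (h0 x).eq_or_lt with hx | hx
      · rw [hz x hx.symm]
        simpa using hasDerivAt_const (0 : ℝ) (0 : ℝ)
      · simpa using (Real.hasStrictDerivAt_const_rpow hx 0).hasDerivAt.const_mul (P x)
    have hl := hd.log (by rw [hf0]; exact one_ne_zero)
    rw [hf0, div_one] at hl
    have hslope := hl.tendsto_slope_zero_right
    have hpos : ∀ᶠ s in 𝓝[>] (0 : ℝ), 0 < f s :=
      (hd.continuousAt.eventually_const_lt (by rw [hf0]; exact one_pos)).filter_mono
        nhdsWithin_le_nhds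
    have hprod : ∏ x, a x ^ P x = Real.exp (∑ x, P x * Real.log (a x)) := by
      rw [Real.exp_sum]
      refine Finset.prod_congr rfl fun x _ => ?_
      rcases (h0 x).eq_or_lt with hx | hx
      · simp [hz x hx.symm]
      · rw [Real.rpow_def_of_pos hx, mul_comm]
    rw [hprod]
    refine ((Real.continuous_exp.tendsto _).comp hslope).congr' ?_
    filter_upwards [hpos] with s hs
    simp only [Function.comp, zero_add, hf0, Real.log_one, sub_zero, smul_eq_mul]
    rw [Real.rpow_def_of_pos hs]
    congr 1
    ring

theorem tendsto_gallagerSum (P : Prob X) (W : Channel X Y) :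
    Tendsto (fun s : ℝ => gallagerSum s P W) (𝓝[>] 0) (𝓝 (∑ y, ∏ x, W x y ^ P x)) :=
  tendsto_finsetSum _ fun y _ =>
    tendsto_powerMean P (fun x => (W x).nonneg y) (fun x => (W x).le_one y)

/-- The optimal output distribution is the normalised geometric mean of the rows of the channel. -/
theorem iInf_relEntropy_le_neg_log (P : Prob X) (W : Channel X Y) :
    ⨅ Q : Prob Y, relEntropy (prodDist P Q) (jointDist P W)
      ≤ -ENNReal.log (ENNReal.ofReal (∑ y, ∏ x, W x y ^ P x)) := by
  set G : Y → ℝ := fun y => ∏ x, W x y ^ P x with hG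
  have hG0 : ∀ y, 0 ≤ G y := fun y =>
    Finset.prod_nonneg fun x _ => Real.rpow_nonneg ((W x).nonneg y) _
  have hP : ∑ x, P x = 1 := P.sum_eq_one
  rcases (Finset.sum_nonneg fun y (_ : y ∈ Finset.univ) => hG0 y).eq_or_lt with hS | hS
  · change _ ≤ -ENNReal.log (ENNReal.ofReal (∑ y, G y))
    rw [← hS]
    simp
  · set S := ∑ y, G y with hSdef
    let Q : Prob Y := ⟨fun y => G y / S, fun y => div_nonneg (hG0 y) hS.le, by
      rw [← Finset.sum_div, div_self hS.ne']⟩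
    have hQ : ∀ y, Q y = G y / S := fun _ => rfl
    have hQ1 : ∑ y, Q y = 1 := Q.sum_eq_one
    have hzero : ∀ x y, W x y = 0 → P x ≠ 0 → G y = 0 := fun x y hw hp =>
      Finset.prod_eq_zero (Finset.mem_univ x) (by rw [hw, Real.zero_rpow hp])
    refine (iInf_le _ Q).trans ?_
    rw [relEntropy_prodDist_jointDist, ENNReal.log_ofReal_of_pos hS, ← EReal.coe_neg,
      EReal.coe_le_coe_iff]
    · rw [Finset.sum_comm]
      have key : ∀ y, ∑ x, P x * Q y * Real.log (Q y / W x y) = Q y * -Real.log S := by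
        intro y
        rcases (hG0 y).eq_or_lt with hy | hy
        · simp [hQ, ← hy]
        · have hlogG : Real.log (G y) = ∑ x, P x * Real.log (W x y) := by
            rw [hG, Real.log_prod (fun x _ => (Finset.prod_ne_zero_iff.1 hy.ne') x
              (Finset.mem_univ x))]
            refine Finset.sum_congr rfl fun x _ => ?_
            rcases ((W x).nonneg y).eq_or_lt with hw | hw
            · by_cases hp : P x = 0
              · simp [hp]
              · exact absurd (hzero x y hw.symm hp) hy.ne'
            · rw [Real.log_rpow hw]
          have hterm : ∀ x, P x * Q y * Real.log (Q y / W x y)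
              = Q y * (P x * (Real.log (G y) - Real.log S)) - Q y * (P x * Real.log (W x y)) := by
            intro x
            by_cases hp : P x = 0
            · simp [hp]
            · have hw : W x y ≠ 0 := fun hw => hy.ne' (hzero x y hw hp)
              rw [Real.log_div (by rw [hQ]; positivity) hw, hQ y,
                Real.log_div hy.ne' hS.ne']
              ring
          simp only [hterm, Finset.sum_sub_distrib, ← Finset.mul_sum, ← Finset.sum_mul, hP,
            ← hlogG]
          ring
      simp only [key, ← Finset.sum_mul, hQ1, one_mul, le_refl]
    · intro x y hw
      by_cases hp : P x = 0
      · rw [hp, zero_mul]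
      · rw [hQ, hzero x y hw hp, zero_div, mul_zero]

/-- A function of the rate that dominates all straight lines `-log (gallagerSum s P W) - c s * r` is
at least the umlaut information in the limit of zero rate. -/
theorem channelUmlaut_le_liminf (W : Channel X Y) (F : ℝ → EReal) (c : ℝ → ℝ)
    (hF : ∀ r : ℝ, 0 < r → ∀ s : ℝ, 0 < s → s < 1 → ∀ P : Prob X,
      -ENNReal.log (ENNReal.ofReal (gallagerSum s P W)) - ((c s * r : ℝ) : EReal) ≤ F r) :
    channelUmlaut W ≤ liminf F (𝓝[>] 0) := by
  refine iSup_le fun P => (iInf_relEntropy_le_neg_log P W).trans ?_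
  have hlim : Tendsto (fun s : ℝ => -ENNReal.log (ENNReal.ofReal (gallagerSum s P W))) (𝓝[>] 0)
      (𝓝 (-ENNReal.log (ENNReal.ofReal (∑ y, ∏ x, W x y ^ P x)))) :=
    ((continuous_neg.comp ENNReal.continuous_log).comp
      ENNReal.continuous_ofReal).continuousAt.tendsto.comp (tendsto_gallagerSum P W)
  refine le_of_tendsto hlim ?_
  filter_upwards [Ioo_mem_nhdsGT one_pos] with s hs
  have hr : Tendsto (fun r : ℝ => -ENNReal.log (ENNReal.ofReal (gallagerSum s P W))
      - ((c s * r : ℝ) : EReal)) (𝓝[>] 0)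
      (𝓝 (-ENNReal.log (ENNReal.ofReal (gallagerSum s P W)))) := by
    have h0 : Tendsto (fun r : ℝ => ((-(c s * r) : ℝ) : EReal)) (𝓝[>] 0) (𝓝 0) := by
      have : Continuous (fun r : ℝ => ((-(c s * r) : ℝ) : EReal)) :=
        continuous_coe_real_ereal.comp (by fun_prop)
      have := (this.tendsto 0).mono_left (nhdsWithin_le_nhds (s := Set.Ioi 0))
      simpa using this
    have hadd := (EReal.continuousAt_add
      (p := (-ENNReal.log (ENNReal.ofReal (gallagerSum s P W)), 0))
      (by simp) (by simp)).tendsto.comp (tendsto_const_nhds.prodMk_nhds h0)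
    simpa [Function.comp_def, sub_eq_add_neg] using hadd
  rw [← hr.liminf_eq]
  refine liminf_le_liminf ?_
  filter_upwards [self_mem_nhdsWithin] with r hr
  exact hF r hr s hs.1 hs.2 P

end SingleLetter

/-! ### Product channels -/

theorem Channel.pow_apply {X Y : Type*} [Fintype Y] {n : ℕ} (W : Channel X Y) (x : Fin n → X)
    (y : Fin n → Y) : W.pow n x y = ∏ i, W (x i) (y i) := rfl

section Product

variable {X Y : Type*} [Fintype X] [Fintype Y] {n : ℕ}

/-- The product of the distributions `Q i`, viewed as the output of the channel with input alphabet
`Fin n` on the input `(0, …, n - 1)`. -/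
noncomputable def piDist (Q : Fin n → Prob Y) : Prob (Fin n → Y) := Channel.pow Q n id

theorem piDist_apply (Q : Fin n → Prob Y) (y : Fin n → Y) : piDist Q y = ∏ i, Q i (y i) := rfl

/-- Gallager sums are multiplicative on i.i.d. inputs. -/
theorem gallagerSum_pow (s : ℝ) (P : Prob X) (W : Channel X Y) :
    gallagerSum s (piDist fun _ : Fin n => P) (W.pow n) = gallagerSum s P W ^ n := by
  rw [gallagerSum, gallagerSum, Fintype.sum_pow]
  refine Finset.sum_congr rfl fun y _ => ?_
  rw [Real.finsetProd_rpow _ _ fun i _ => sum_mul_rpow_nonneg s P W (y i)]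
  congr 1
  have := Finset.prod_univ_sum (fun _ : Fin n => (Finset.univ : Finset X))
      (fun i x => P x * W x (y i) ^ s)
  rw [this, Fintype.piFinset_univ]
  refine Finset.sum_congr rfl fun x _ => ?_
  rw [Finset.prod_mul_distrib, piDist_apply, Channel.pow_apply,
    Real.finsetProd_rpow _ _ fun i _ => (W (x i)).nonneg (y i)]

theorem sum_piDist_mul (Q : Fin n → Prob Y) (i : Fin n) (f : Y → ℝ) :
    ∑ y, piDist Q y * f (y i) = ∑ b, Q i b * f b := by
  classical
  have h1 : ∀ y : Fin n → Y, piDist Q y * f (y i)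
      = ∏ j, Q j (y j) * if j = i then f (y j) else 1 := by
    intro y
    rw [Finset.prod_mul_distrib, piDist_apply, Finset.prod_ite_eq' Finset.univ i]
    simp
  simp only [h1]
  have := Finset.prod_univ_sum (fun _ : Fin n => (Finset.univ : Finset Y))
      (fun j b => Q j b * if j = i then f b else 1)
  rw [Fintype.piFinset_univ] at this
  rw [← this, Finset.prod_eq_single i]
  · simp
  · intro j _ hj
    have hQ : ∑ y, Q j y = 1 := (Q j).sum_eq_one
    simp [hj, hQ]
  · simp

open scoped Classical in
/-- The law of the `i`-th letter of a random word with law `P`. -/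
noncomputable def marginal (P : Prob (Fin n → X)) (i : Fin n) : Prob X :=
  ⟨fun a => ∑ x, if x i = a then P x else 0, fun a => Finset.sum_nonneg fun x _ => by
    split_ifs
    exacts [P.nonneg x, le_rfl], by
    have hP : ∑ x, P x = 1 := P.sum_eq_one
    rw [Finset.sum_comm]
    simp [hP]⟩

open scoped Classical in
theorem marginal_apply (P : Prob (Fin n → X)) (i : Fin n) (a : X) :
    marginal P i a = ∑ x, if x i = a then P x else 0 := rfl

theorem sum_mul_eq_sum_marginal (P : Prob (Fin n → X)) (i : Fin n) (h : X → ℝ) :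
    ∑ x, P x * h (x i) = ∑ a, marginal P i a * h a := by
  classical
  simp only [marginal_apply, Finset.sum_mul]
  rw [Finset.sum_comm]
  simp [ite_mul]

theorem le_marginal (P : Prob (Fin n → X)) (i : Fin n) (x : Fin n → X) :
    P x ≤ marginal P i (x i) := by
  classical
  have := Finset.single_le_sum (f := fun x' => if x' i = x i then P x' else 0)
    (fun x' _ => by
      split_ifs
      exacts [P.nonneg x', le_rfl]) (Finset.mem_univ x)
  simpa [marginal_apply] using this

/-- Subadditivity of the umlaut information: since `log W^n(y|x)` is a sum over the letters,
`D(PQ‖PW^n)` for a product distribution `Q` depends on `P` only through its marginals. -/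
theorem exists_output_pow (W : Channel X Y) {u : ℝ}
    (hu : ∀ P : Prob X, ∃ Q : Prob Y, (∀ x y, W x y = 0 → P x * Q y = 0) ∧
      ∑ x, ∑ y, P x * Q y * Real.log (Q y / W x y) ≤ u) (P : Prob (Fin n → X)) :
    ∃ Q : Prob (Fin n → Y), (∀ x y, W.pow n x y = 0 → P x * Q y = 0) ∧
      ∑ x, ∑ y, P x * Q y * Real.log (Q y / W.pow n x y) ≤ n * u := by
  choose Q hQ hQu using fun i => hu (marginal P i)
  have hac : ∀ x y, W.pow n x y = 0 → P x * piDist Q y = 0 := by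
    intro x y hxy
    obtain ⟨i, _, hi⟩ := Finset.prod_eq_zero_iff.1 (W.pow_apply x y ▸ hxy)
    rcases mul_eq_zero.1 (hQ i _ _ hi) with h | h
    · rw [le_antisymm (h ▸ le_marginal P i x) (P.nonneg x), zero_mul]
    · rw [piDist_apply, Finset.prod_eq_zero (Finset.mem_univ i) h, mul_zero]
  refine ⟨piDist Q, hac, ?_⟩
  have hterm : ∀ x y, P x * piDist Q y * Real.log (piDist Q y / W.pow n x y)
      = ∑ i, P x * (piDist Q y * Real.log (Q i (y i) / W (x i) (y i))) := by
    intro x y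
    by_cases h : P x * piDist Q y = 0
    · rw [h, zero_mul, Finset.sum_eq_zero]
      intro i _
      rw [← mul_assoc, h, zero_mul]
    · have hW : W.pow n x y ≠ 0 := fun h' => h (hac x y h')
      have hq : piDist Q y ≠ 0 := right_ne_zero_of_mul h
      rw [piDist_apply, Finset.prod_ne_zero_iff] at hq
      rw [Channel.pow_apply, Finset.prod_ne_zero_iff] at hW
      conv_lhs => rw [piDist_apply, Channel.pow_apply, ← Finset.prod_div_distrib,
        Real.log_prod fun i hi => div_ne_zero (hq i hi) (hW i hi), Finset.mul_sum]
      exact Finset.sum_congr rfl fun i _ => by rw [piDist_apply]; ring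
  calc ∑ x, ∑ y, P x * piDist Q y * Real.log (piDist Q y / W.pow n x y)
      = ∑ x, ∑ i, P x * ∑ b, Q i b * Real.log (Q i b / W (x i) b) := by
        refine Finset.sum_congr rfl fun x _ => ?_
        simp only [hterm]
        rw [Finset.sum_comm]
        refine Finset.sum_congr rfl fun i _ => ?_
        rw [← Finset.mul_sum, sum_piDist_mul Q i fun b => Real.log (Q i b / W (x i) b)]
    _ = ∑ i, ∑ a, marginal P i a * ∑ b, Q i b * Real.log (Q i b / W a b) := by
        rw [Finset.sum_comm]
        refine Finset.sum_congr rfl fun i _ => ?_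
        rw [sum_mul_eq_sum_marginal P i fun a => ∑ b, Q i b * Real.log (Q i b / W a b)]
    _ ≤ ∑ _i : Fin n, u := by
        refine Finset.sum_le_sum fun i _ => le_trans (le_of_eq ?_) (hQu i)
        simp only [Finset.mul_sum, mul_assoc]
    _ = n * u := by simp

end Product

/-! ### Error exponents of non-signalling codes -/

section Exponents

variable {X Y : Type*} [Fintype X] [Fintype Y]

theorem le_nsErrorRate (W : Channel X Y) {M n : ℕ} {b : ℝ} (hb : 0 < b)
    (h : nsError M (W.pow n) ≤ b) : ((-Real.log b / n : ℝ) : EReal) ≤ nsErrorRate M n W := by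
  have h1 : ((-Real.log b : ℝ) : EReal)
      ≤ -ENNReal.log (ENNReal.ofReal (nsError M (W.pow n))) := by
    rw [EReal.coe_neg, EReal.neg_le_neg_iff, ← ENNReal.log_ofReal_of_pos hb]
    exact ENNReal.log_monotone (ENNReal.ofReal_le_ofReal h)
  rw [nsErrorRate, div_eq_mul_one_div (-Real.log b), mul_comm (-Real.log b), EReal.coe_mul]
  exact mul_le_mul_of_nonneg_left h1 (EReal.coe_nonneg.2 (one_div_nonneg.2 n.cast_nonneg))

theorem nsErrorRate_le (W : Channel X Y) {M n : ℕ} {b : ℝ} (hb : 0 < b)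
    (h : b ≤ nsError M (W.pow n)) : nsErrorRate M n W ≤ ((-Real.log b / n : ℝ) : EReal) := by
  have h1 : -ENNReal.log (ENNReal.ofReal (nsError M (W.pow n)))
      ≤ ((-Real.log b : ℝ) : EReal) := by
    rw [EReal.coe_neg, EReal.neg_le_neg_iff, ← ENNReal.log_ofReal_of_pos hb]
    exact ENNReal.log_monotone (ENNReal.ofReal_le_ofReal h)
  rw [nsErrorRate, div_eq_mul_one_div (-Real.log b), mul_comm (-Real.log b), EReal.coe_mul]
  exact mul_le_mul_of_nonneg_left h1 (EReal.coe_nonneg.2 (one_div_nonneg.2 n.cast_nonneg))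

theorem nsErrorRate_anti [Nonempty X] (W : Channel X Y) {M M' : ℕ} (n : ℕ) (hM : 0 < M)
    (h : M ≤ M') : nsErrorRate M' n W ≤ nsErrorRate M n W := by
  refine mul_le_mul_of_nonneg_left ?_ (by exact_mod_cast (by positivity : (0 : ℝ) ≤ 1 / n))
  rw [EReal.neg_le_neg_iff]
  exact ENNReal.log_monotone (ENNReal.ofReal_le_ofReal (nsError_mono _ hM h))

/-- Achievability for the product channel, from `nsError_le_gallagerSum` with i.i.d. inputs.
Rounding the number of messages up costs at most a factor `2`. -/
theorem le_nsExponent [Nonempty X] (W : Channel X Y) {r s : ℝ} (hr : 0 < r) (hs : 0 < s)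
    (P : Prob X) :
    -ENNReal.log (ENNReal.ofReal (gallagerSum s P W)) - ((s⁻¹ * r : ℝ) : EReal)
      ≤ nsExponent r W := by
  set g := gallagerSum s P W with hg
  have hM : ∀ n : ℕ, 0 < ⌈Real.exp (r * n)⌉₊ := fun n => Nat.ceil_pos.2 (Real.exp_pos _)
  have hbound : ∀ n : ℕ, nsError ⌈Real.exp (r * n)⌉₊ (W.pow n)
      ≤ (⌈Real.exp (r * n)⌉₊ : ℝ) ^ (1 / s) * g ^ n := by
    intro n
    rw [hg, ← gallagerSum_pow]
    exact nsError_le_gallagerSum _ _ (hM n) hs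
  -- If the Gallager sum vanishes, so does the error, and both sides are infinite.
  rcases (gallagerSum_nonneg s P W).eq_or_lt with h0 | h0
  · refine le_top.trans ?_
    refine le_liminf_of_le (by isBoundedDefault) ?_
    filter_upwards [eventually_gt_atTop 0] with n hn
    have h := hbound n
    rw [hg, ← h0, zero_pow hn.ne', mul_zero] at h
    have hn' : (0 : ℝ) < 1 / n := by positivity
    rw [nsErrorRate, ENNReal.ofReal_of_nonpos h, ENNReal.log_zero, EReal.neg_bot,
      EReal.coe_mul_top_of_pos hn']
  · rw [ENNReal.log_ofReal_of_pos h0, ← EReal.coe_neg, ← EReal.coe_sub]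
    have hlim : Tendsto (fun n : ℕ => ((-Real.log g - s⁻¹ * r - s⁻¹ * Real.log 2 / n : ℝ) : EReal))
        atTop (𝓝 ((-Real.log g - s⁻¹ * r : ℝ) : EReal)) := by
      refine (continuous_coe_real_ereal.tendsto _).comp ?_
      simpa using (tendsto_const_nhds (x := -Real.log g - s⁻¹ * r)).sub
        (tendsto_const_div_atTop_nhds_zero_nat (s⁻¹ * Real.log 2))
    rw [← hlim.liminf_eq]
    refine liminf_le_liminf ?_
    filter_upwards [eventually_gt_atTop 0] with n hn
    have hn' : (0 : ℝ) < n := by exact_mod_cast hn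
    have hMr : (0 : ℝ) < ⌈Real.exp (r * n)⌉₊ := by exact_mod_cast hM n
    refine le_trans ?_ (le_nsErrorRate W (by positivity) (hbound n))
    rw [EReal.coe_le_coe_iff, Real.log_mul (by positivity) (by positivity), Real.log_pow,
      Real.log_rpow hMr]
    have hlogM : Real.log ⌈Real.exp (r * n)⌉₊ ≤ Real.log 2 + r * n := by
      have h1 : 1 ≤ Real.exp (r * n) := Real.one_le_exp (by positivity)
      have h2 := (Nat.ceil_lt_add_one (Real.exp_pos (r * n)).le).le
      calc Real.log ⌈Real.exp (r * n)⌉₊ ≤ Real.log (2 * Real.exp (r * n)) :=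
            Real.log_le_log hMr (by linarith)
        _ = _ := by rw [Real.log_mul two_ne_zero (Real.exp_pos _).ne', Real.log_exp]
    have h3 := mul_le_mul_of_nonneg_left hlogM (inv_pos.2 hs).le
    rw [le_div_iff₀ hn', one_div]
    have h4 : (-Real.log g - s⁻¹ * r - s⁻¹ * Real.log 2 / n) * n
        = -Real.log g * n - s⁻¹ * r * n - s⁻¹ * Real.log 2 := by
      field_simp
    rw [h4]
    nlinarith

theorem channelUmlaut_le_nsZeroRateExponent [Nonempty X] (W : Channel X Y) :
    channelUmlaut W ≤ nsZeroRateExponent W :=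
  channelUmlaut_le_liminf W (fun r => nsExponent r W) (fun s => s⁻¹)
    fun _ hr _ hs _ P => le_nsExponent W hr hs P

/-- The error grows with the number of messages, and `⌈exp (r n)⌉` eventually exceeds every fixed
number of messages. -/
theorem nsZeroRateExponent_le_nsFixedSizeExponent [Nonempty X] (W : Channel X Y) :
    nsZeroRateExponent W ≤ nsFixedSizeExponent W := by
  refine le_liminf_of_le (by isBoundedDefault) ?_
  filter_upwards [eventually_gt_atTop 0] with M hM
  have h : ∀ r : ℝ, 0 < r → nsExponent r W ≤ liminf (fun n : ℕ => nsErrorRate M n W) atTop := by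
    intro r hr
    refine liminf_le_liminf ?_
    have ht : Tendsto (fun n : ℕ => Real.exp (r * n)) atTop atTop :=
      Real.tendsto_exp_atTop.comp (tendsto_natCast_atTop_atTop.const_mul_atTop hr)
    filter_upwards [ht.eventually_ge_atTop (M : ℝ)] with n hn
    refine nsErrorRate_anti W n hM ?_
    exact_mod_cast hn.trans (Nat.le_ceil _)
  calc nsZeroRateExponent W
      ≤ liminf (fun _ : ℝ => liminf (fun n : ℕ => nsErrorRate M n W) atTop) (𝓝[>] 0) := by
        refine liminf_le_liminf ?_
        filter_upwards [self_mem_nhdsWithin] with r hr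
        exact h r hr
    _ = _ := liminf_const _

/-- The one-shot converse: a bound on `inf_Q D(PQ‖PW)` uniform in `P` bounds the error of every code
from below. -/
theorem exp_le_nsError [Nonempty X] (W : Channel X Y) {M : ℕ} (hM : 2 ≤ M) {D : ℝ}
    (hD : ∀ P : Prob X, ∃ Q : Prob Y, (∀ x y, W x y = 0 → P x * Q y = 0) ∧
      ∑ x, ∑ y, P x * Q y * Real.log (Q y / W x y) ≤ D) :
    Real.exp (-((D + 1) / (1 - 1 / M))) ≤ nsError M W := by
  have hM0 : 0 < M := by omega
  have := nonempty_output W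
  obtain ⟨Z₀, hZ₀⟩ := exists_isNonSignalling (X := X) (Y := Y) hM0
  have : Nonempty {Z : Code X Y M // Z.IsNonSignalling} := ⟨⟨Z₀, hZ₀⟩⟩
  refine le_ciInf fun Z => ?_
  obtain ⟨P, R, h0, h1, h2, he⟩ := Z.2.exists_errorProb_eq hM0 W
  obtain ⟨Q, hac, hQ⟩ := hD P
  rw [he]
  refine exp_le_error_of_test W P Q R ?_ h0 h1 h2 hac hQ
  rw [div_lt_one (by exact_mod_cast hM0)]
  exact_mod_cast hM

/-- For a code with `M` messages the converse gives the exponent `u / (1 - 1 / M)` for every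
`u` above the umlaut information; the factor disappears as `M` grows. -/
theorem nsFixedSizeExponent_le_channelUmlaut [Nonempty X] (W : Channel X Y) :
    nsFixedSizeExponent W ≤ channelUmlaut W := by
  refine EReal.le_of_forall_lt_iff_le.1 fun u hu => ?_
  have hQ : ∀ P : Prob X, ∃ Q : Prob Y, (∀ x y, W x y = 0 → P x * Q y = 0) ∧
      ∑ x, ∑ y, P x * Q y * Real.log (Q y / W x y) ≤ u := by
    intro P
    have hlt : ⨅ Q : Prob Y, relEntropy (prodDist P Q) (jointDist P W) < u :=
      (le_iSup (fun P : Prob X => ⨅ Q : Prob Y, relEntropy (prodDist P Q) (jointDist P W))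
        P).trans_lt hu
    obtain ⟨Q, hQ⟩ := iInf_lt_iff.1 hlt
    have hac := mul_eq_zero_of_relEntropy_ne_top hQ.ne_top
    refine ⟨Q, hac, ?_⟩
    rw [relEntropy_prodDist_jointDist P Q W hac] at hQ
    exact (EReal.coe_lt_coe_iff.1 hQ).le
  have hrate : ∀ M n : ℕ, 2 ≤ M → nsErrorRate M n W
      ≤ (((n * u + 1) / (1 - 1 / M) / n : ℝ) : EReal) := by
    intro M n hM
    have h := nsErrorRate_le W (Real.exp_pos _)
      (exp_le_nsError (W.pow n) hM (exists_output_pow W hQ))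
    rwa [Real.log_exp, neg_neg] at h
  have hinner : ∀ M : ℕ, 2 ≤ M → liminf (fun n : ℕ => nsErrorRate M n W) atTop
      ≤ ((u / (1 - 1 / M) : ℝ) : EReal) := by
    intro M hM
    have hlim : Tendsto (fun n : ℕ => (((n * u + 1) / (1 - 1 / M) / n : ℝ) : EReal)) atTop
        (𝓝 ((u / (1 - 1 / M) : ℝ) : EReal)) := by
      refine (continuous_coe_real_ereal.tendsto _).comp ?_
      have h1 : Tendsto (fun n : ℕ => (u + 1 / (n : ℝ)) / (1 - 1 / (M : ℝ))) atTop
          (𝓝 ((u + 0) / (1 - 1 / (M : ℝ)))) :=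
        (tendsto_const_nhds.add tendsto_one_div_atTop_nhds_zero_nat).div_const _
      rw [add_zero] at h1
      refine h1.congr' ?_
      filter_upwards [eventually_gt_atTop 0] with n hn
      have hn' : (n : ℝ) ≠ 0 := by positivity
      rw [div_right_comm, add_div (n * u), mul_div_cancel_left₀ _ hn']
    rw [← hlim.liminf_eq]
    exact liminf_le_liminf (Eventually.of_forall fun n => hrate M n hM)
  have hlim : Tendsto (fun M : ℕ => ((u / (1 - 1 / M) : ℝ) : EReal)) atTop (𝓝 (u : EReal)) := by
    refine (continuous_coe_real_ereal.tendsto _).comp ?_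
    have h1 : Tendsto (fun M : ℕ => u / (1 - 1 / (M : ℝ))) atTop (𝓝 (u / (1 - 0))) :=
      tendsto_const_nhds.div (tendsto_const_nhds.sub tendsto_one_div_atTop_nhds_zero_nat)
        (by norm_num)
    simpa using h1
  rw [← hlim.liminf_eq]
  refine liminf_le_liminf ?_
  filter_upwards [eventually_ge_atTop 2] with M hM
  exact hinner M hM

end Exponents

/-! ### The sphere-packing bound at zero rate -/

section SpherePacking

variable {X Y : Type*} [Fintype X] [Fintype Y]

theorem renyiDiv_prodDist (P : Prob X) (Q : Prob Y) (W : Channel X Y) {a : ℝ} (h0 : 0 < a)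
    (h1 : a < 1) :
    renyiDiv a (jointDist P W) (prodDist P Q) = (((a - 1)⁻¹ : ℝ) : EReal) *
      ENNReal.log (ENNReal.ofReal (∑ y, (∑ x, P x * W x y ^ a) * Q y ^ (1 - a))) := by
  rw [renyiDiv, if_neg h1.ne, Fintype.sum_prod_type, Finset.sum_comm,
    ENNReal.ofReal_sum_of_nonneg fun y _ =>
      mul_nonneg (sum_mul_rpow_nonneg a P W y) (Real.rpow_nonneg (Q.nonneg y) _)]
  congr 2
  refine Finset.sum_congr rfl fun y _ => ?_
  rw [Finset.sum_mul, ENNReal.ofReal_sum_of_nonneg fun x _ => mul_nonneg (mul_nonneg (P.nonneg x)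
    (Real.rpow_nonneg ((W x).nonneg y) _)) (Real.rpow_nonneg (Q.nonneg y) _)]
  refine Finset.sum_congr rfl fun x _ => ?_
  change ENNReal.ofReal (W x y * P x) ^ a * ENNReal.ofReal (P x * Q y) ^ (1 - a) = _
  have hW := (W x).nonneg y
  have hQ := Q.nonneg y
  rcases (P.nonneg x).eq_or_lt with hP | hP
  · rw [← hP]
    simp [h0]
  · rw [ENNReal.ofReal_rpow_of_nonneg (mul_nonneg hW hP.le) h0.le,
      ENNReal.ofReal_rpow_of_nonneg (mul_nonneg hP.le hQ) (sub_nonneg.2 h1.le),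
      ← ENNReal.ofReal_mul (by positivity), Real.mul_rpow hW hP.le, Real.mul_rpow hP.le hQ]
    congr 1
    have : P x ^ a * P x ^ (1 - a) = P x := by
      rw [← Real.rpow_add hP, add_sub_cancel, Real.rpow_one]
    linear_combination (W x y ^ a * Q y ^ (1 - a)) * this

/-- Hölder's inequality: `gallagerSum` is what optimising the output distribution leaves of the
Rényi divergence. -/
theorem sum_mul_rpow_le_gallagerSum (P : Prob X) (Q : Prob Y) (W : Channel X Y) {a : ℝ}
    (h0 : 0 < a) (h1 : a < 1) :
    ∑ y, (∑ x, P x * W x y ^ a) * Q y ^ (1 - a) ≤ gallagerSum a P W ^ a := by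
  have hQ : ∑ y, Q y = 1 := Q.sum_eq_one
  have hpq : (1 / a).HolderConjugate (1 / (1 - a)) := by
    rw [Real.holderConjugate_iff]
    constructor
    · rw [lt_div_iff₀ h0]; linarith
    · simp
  have h := Real.inner_le_Lp_mul_Lq_of_nonneg Finset.univ hpq
    (f := fun y => ∑ x, P x * W x y ^ a) (g := fun y => Q y ^ (1 - a))
    (fun y _ => sum_mul_rpow_nonneg a P W y) (fun y _ => Real.rpow_nonneg (Q.nonneg y) _)
  refine h.trans_eq ?_
  have h2 : ∀ y, (Q y ^ (1 - a)) ^ (1 / (1 - a)) = Q y := by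
    intro y
    rw [← Real.rpow_mul (Q.nonneg y), mul_one_div_cancel (by linarith), Real.rpow_one]
  simp only [h2, hQ, Real.one_rpow, mul_one, one_div_one_div]
  rfl

/-- Jensen's inequality: for `0 < a < 1`, the Rényi divergence `D_a(P_XY‖PQ)` multiplied by
`(1 - a) / a` is at most the relative entropy with exchanged arguments, `D(PQ‖P_XY)`. -/
theorem neg_mul_sum_log_le_log_sum (P : Prob X) (Q : Prob Y) (W : Channel X Y) (a : ℝ)
    (hac : ∀ x y, W x y = 0 → P x * Q y = 0) :
    0 < ∑ y, (∑ x, P x * W x y ^ a) * Q y ^ (1 - a) ∧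
    -(a * ∑ x, ∑ y, P x * Q y * Real.log (Q y / W x y))
      ≤ Real.log (∑ y, (∑ x, P x * W x y ^ a) * Q y ^ (1 - a)) := by
  set S := ∑ y, (∑ x, P x * W x y ^ a) * Q y ^ (1 - a) with hS
  have hP : ∑ x, P x = 1 := P.sum_eq_one
  have hQ : ∑ y, Q y = 1 := Q.sum_eq_one
  have hPQ : ∑ x, ∑ y, P x * Q y = 1 := by
    simp only [← Finset.mul_sum, hQ, mul_one, hP]
  have hS' : S = ∑ x, ∑ y, P x * W x y ^ a * Q y ^ (1 - a) := by
    rw [Finset.sum_comm, hS]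
    simp only [Finset.sum_mul]
  have hterm0 : ∀ x y, 0 ≤ P x * W x y ^ a * Q y ^ (1 - a) := fun x y =>
    mul_nonneg (mul_nonneg (P.nonneg x) (Real.rpow_nonneg ((W x).nonneg y) _))
      (Real.rpow_nonneg (Q.nonneg y) _)
  have hSpos : 0 < S := by
    rw [hS']
    obtain ⟨x, _, hx⟩ := Finset.exists_ne_zero_of_sum_ne_zero (by rw [hPQ]; exact one_ne_zero)
    obtain ⟨y, _, hy⟩ := Finset.exists_ne_zero_of_sum_ne_zero hx
    have hw : 0 < W x y := lt_of_le_of_ne ((W x).nonneg y) fun h => hy (hac x y h.symm)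
    have hp : 0 < P x := lt_of_le_of_ne (P.nonneg x) (left_ne_zero_of_mul hy).symm
    have hq : 0 < Q y := lt_of_le_of_ne (Q.nonneg y) (right_ne_zero_of_mul hy).symm
    refine Finset.sum_pos' (fun x _ => Finset.sum_nonneg fun y _ => hterm0 x y)
      ⟨x, Finset.mem_univ x, Finset.sum_pos' (fun y _ => hterm0 x y)
        ⟨y, Finset.mem_univ y, by positivity⟩⟩
  refine ⟨hSpos, ?_⟩
  -- Concavity of the logarithm enters through `log t ≤ t - 1` at `t = (W / Q) ^ a / S`.
  have key : ∀ x y, P x * Q y * (1 - Real.log S) - P x * W x y ^ a * Q y ^ (1 - a) / S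
      ≤ a * (P x * Q y * Real.log (Q y / W x y)) := by
    intro x y
    by_cases h : P x * Q y = 0
    · rw [h]
      have := div_nonneg (hterm0 x y) hSpos.le
      linarith
    · have hw : 0 < W x y := lt_of_le_of_ne ((W x).nonneg y) fun h' => h (hac x y h'.symm)
      have hp : 0 < P x := lt_of_le_of_ne (P.nonneg x) (left_ne_zero_of_mul h).symm
      have hq : 0 < Q y := lt_of_le_of_ne (Q.nonneg y) (right_ne_zero_of_mul h).symm
      have h1 := Real.log_le_sub_one_of_pos (x := (W x y / Q y) ^ a / S) (by positivity)
      rw [Real.log_div (by positivity) hSpos.ne', Real.log_rpow (by positivity),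
        Real.log_div hw.ne' hq.ne', Real.div_rpow hw.le hq.le] at h1
      rw [Real.log_div hq.ne' hw.ne', Real.rpow_sub hq, Real.rpow_one]
      have h2 := mul_le_mul_of_nonneg_left h1 (mul_pos hp hq).le
      have h3 : P x * Q y * (W x y ^ a / Q y ^ a / S - 1)
          = P x * W x y ^ a * (Q y / Q y ^ a) / S - P x * Q y := by
        field_simp
      rw [h3] at h2
      linarith
  have hsum := Finset.sum_le_sum fun x (_ : x ∈ Finset.univ) =>
    Finset.sum_le_sum fun y (_ : y ∈ Finset.univ) => key x y
  simp only [Finset.sum_sub_distrib, ← Finset.sum_mul, ← Finset.sum_div] at hsum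
  rw [hPQ, ← hS', div_self hSpos.ne'] at hsum
  have hmul : ∑ x, ∑ y, a * (P x * Q y * Real.log (Q y / W x y))
      = a * ∑ x, ∑ y, P x * Q y * Real.log (Q y / W x y) := by
    simp only [Finset.mul_sum]
  linarith

theorem spherePacking_le_channelUmlaut (W : Channel X Y) {r : ℝ} (hr : 0 < r) :
    spherePacking r W ≤ channelUmlaut W := by
  refine iSup_le fun a => iSup_mono fun P => iInf_mono fun Q => ?_
  obtain ⟨a, h0, h1⟩ := a
  dsimp only
  rcases h1.eq_or_lt with rfl | h1
  · simpa using relEntropy_nonneg _ _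
  by_cases htop : relEntropy (prodDist P Q) (jointDist P W) = ⊤
  · rw [htop]; exact le_top
  have hac := mul_eq_zero_of_relEntropy_ne_top htop
  obtain ⟨hpos, hle⟩ := neg_mul_sum_log_le_log_sum P Q W a hac
  rw [relEntropy_prodDist_jointDist P Q W hac, renyiDiv_prodDist P Q W h0 h1,
    ENNReal.log_ofReal_of_pos hpos, ← EReal.coe_mul, ← EReal.coe_sub, ← EReal.coe_mul,
    EReal.coe_le_coe_iff]
  set L := Real.log (∑ y, (∑ x, P x * W x y ^ a) * Q y ^ (1 - a))
  have ha : 0 < 1 - a := sub_pos.2 h1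
  have hr' : 0 ≤ (1 - a) / a * r := by positivity
  have heq : (1 - a) / a * ((a - 1)⁻¹ * L) = -L / a := by
    have : a - 1 ≠ 0 := by linarith
    field_simp
    ring
  rw [mul_sub, heq]
  have : -L / a ≤ ∑ x, ∑ y, P x * Q y * Real.log (Q y / W x y) := by
    rw [div_le_iff₀ h0]
    linarith
  linarith

theorem le_spherePacking (W : Channel X Y) (r : ℝ) {a : ℝ} (h0 : 0 < a) (h1 : a < 1)
    (P : Prob X) :
    -ENNReal.log (ENNReal.ofReal (gallagerSum a P W)) - (((1 - a) / a * r : ℝ) : EReal)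
      ≤ spherePacking r W := by
  refine le_iSup_of_le ⟨a, h0, h1.le⟩ (le_iSup_of_le P (le_iInf fun Q => ?_))
  dsimp only
  have ha : 0 < 1 - a := sub_pos.2 h1
  have hc : 0 < (1 - a) / a := by positivity
  have hneg : (a - 1)⁻¹ < 0 := inv_lt_zero.2 (by linarith)
  rw [renyiDiv_prodDist P Q W h0 h1]
  set S := ∑ y, (∑ x, P x * W x y ^ a) * Q y ^ (1 - a) with hS
  have hSle : S ≤ gallagerSum a P W ^ a := sum_mul_rpow_le_gallagerSum P Q W h0 h1
  have hS0 : 0 ≤ S := Finset.sum_nonneg fun y _ =>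
    mul_nonneg (sum_mul_rpow_nonneg a P W y) (Real.rpow_nonneg (Q.nonneg y) _)
  rcases hS0.eq_or_lt with hz | hpos
  · rw [← hz, ENNReal.ofReal_zero, ENNReal.log_zero, EReal.coe_mul_bot_of_neg hneg,
      EReal.top_sub_coe, EReal.coe_mul_top_of_pos hc]
    exact le_top
  · have hg : 0 < gallagerSum a P W := by
      refine lt_of_le_of_ne (gallagerSum_nonneg a P W) fun h => ?_
      rw [← h, Real.zero_rpow h0.ne'] at hSle
      linarith
    rw [ENNReal.log_ofReal_of_pos hpos, ENNReal.log_ofReal_of_pos hg, ← EReal.coe_mul,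
      ← EReal.coe_sub, ← EReal.coe_mul, ← EReal.coe_neg, ← EReal.coe_sub, EReal.coe_le_coe_iff]
    have hlog := Real.log_le_log hpos hSle
    rw [Real.log_rpow hg] at hlog
    have heq : (1 - a) / a * ((a - 1)⁻¹ * Real.log S) = -Real.log S / a := by
      have : a - 1 ≠ 0 := by linarith
      field_simp
      ring
    rw [mul_sub, heq]
    have : -Real.log (gallagerSum a P W) ≤ -Real.log S / a := by
      rw [le_div_iff₀ h0]
      linarith
    linarith

theorem tendsto_spherePacking (W : Channel X Y) :
    Tendsto (fun r : ℝ => spherePacking r W) (𝓝[>] 0) (𝓝 (channelUmlaut W)) := by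
  refine tendsto_of_le_liminf_of_limsup_le ?_ ?_
  · exact channelUmlaut_le_liminf W (fun r => spherePacking r W) (fun a => (1 - a) / a)
      fun r _ a h0 h1 P => le_spherePacking W r h0 h1 P
  · refine limsup_le_of_le (by isBoundedDefault) ?_
    filter_upwards [self_mem_nhdsWithin] with r hr
    exact spherePacking_le_channelUmlaut W hr

end SpherePacking

end Umlaut

theorem mainTheorem1 {X Y : Type*} [Fintype X] [Nonempty X] [Fintype Y]
    (W : Umlaut.Channel X Y) :
    Umlaut.nsFixedSizeExponent W = Umlaut.nsZeroRateExponent W ∧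
    Tendsto (fun r : ℝ => Umlaut.spherePacking r W) (𝓝[>] 0)
      (𝓝 (Umlaut.nsZeroRateExponent W)) ∧
    Umlaut.nsZeroRateExponent W = Umlaut.channelUmlaut W := by
  have h1 := Umlaut.channelUmlaut_le_nsZeroRateExponent W
  have h2 := Umlaut.nsZeroRateExponent_le_nsFixedSizeExponent W
  have h3 := Umlaut.nsFixedSizeExponent_le_channelUmlaut W
  have h : Umlaut.nsZeroRateExponent W = Umlaut.channelUmlaut W := le_antisymm (h2.trans h3) h1
  exact ⟨le_antisymm (h3.trans h1) h2, h ▸ Umlaut.tendsto_spherePacking W, h⟩
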